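/- Let $A\in\mathbb{C}^{n\times n}$, $v\in\mathbb{C}^n$ and $m\ge 1$, and suppose that $v,Av,\dots,A^{m-1}v$ are linearly independent (so $m\le n$). Let $v_1,v_2,\dots$ be the vectors produced by the Arnoldi process in exact arithmetic: $v_1=v/\beta$ with $\beta=\|v\|_2$, and $v_{j+1}=w_j/\|w_j\|_2$ with $w_j=Av_j-\sum_{i=1}^{j}(v_i^*Av_j)\,v_i$. Put $V_m=(v_1,\dots,v_m)$, $H_m=V_m^*AV_m$, $h_{m+1,m}=v_{m+1}^*Av_m=\|w_m\|_2\ge 0$ (read as $0$ if $w_m=0$), and $\gamma_m=\prod_{j=1}^{m-1}(H_m)_{j+1,j}$. For $p\in\mathbb{N}_0$ let $\varphi_p(z)=\sum_{k\ge0} z^k/(k+p)!$, for scalars and for square matrices. For $t>0$ define the error of the Krylov propagator $$l_{p,m}(t)=\beta V_m\varphi_p(tH_m)e_1-\varphi_p(tA)v ,$$ the scalar defect $\delta_{p,m}(s)=\beta\, s^p\, e_m^*\varphi_p(sH_m)e_1$, and the defect integral $$L_{p,m}(t)=\frac{h_{m+1,m}}{t^p}\int_0^t|\delta_{p,m}(s)|\,ds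 .$$ Assume that the logarithmic norm satisfies $\mu_2(A)=\max\{\operatorname{Re}(y^*Ay/y^*y): 0\ne y\in\mathbb{C}^n\}\le 0$, and that all eigenvalues $\lambda_1,\dots,\lambda_m$ of $H_m$ (listed with algebraic multiplicity) are real. Then, for every $p\in\mathbb{N}_0$ and $t>0$, with $\xi_j=\operatorname{Re}\lambda_j=\lambda_j$, $$L_{p,m}(t)=\beta\, h_{m+1,m}\,\gamma_m\, t\,(\varphi_{p+1})_t[\xi_1,\dots,\xi_m],$$ where $(\varphi_{p+1})_t$ is the function $z\mapsto\varphi_{p+1}(tz)$ and $f[\xi_1,\dots,\xi_m]$ denotes the (confluent) divided difference of $f$; and $$\|l_{p,m}(t)\|_2\le L_{p,m}(t)=\beta\, h_{m+1,m}\, t\; e_m^*\varphi_{p+1}(tH_m)e_1 .$$ -/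

import Mathlib

noncomputable section

namespace Krylov

/-- The entire function `φ_p(x) = ∑_{k ≥ 0} x^k / (k + p)!`, for complex scalars as well as for
complex square matrices. -/
def phi {𝔸 : Type*} [Semiring 𝔸] [Module ℂ 𝔸] [TopologicalSpace 𝔸] (p : ℕ) (x : 𝔸) : 𝔸 :=
  ∑' k : ℕ, ((Nat.factorial (k + p) : ℂ)⁻¹) • x ^ k

/-- The numerical range `{y^* A y / y^* y : y ≠ 0}` of `A`. -/
def numericalRange {n : ℕ} (A : Matrix (Fin n) (Fin n) ℂ) : Set ℂ :=
  {z | ∃ y : Fin n → ℂ, y ≠ 0 ∧ z = (star y ⬝ᵥ A.mulVec y) / (star y ⬝ᵥ y)}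

/-- The logarithmic norm `μ₂(A)`, the largest real part of a point of the numerical range. -/
def logNorm {n : ℕ} (A : Matrix (Fin n) (Fin n) ℂ) : ℝ :=
  sSup (Complex.re '' numericalRange A)

/-- The Arnoldi vectors: entry `j` is the basis vector `v_{j+1}`.  The first one is `v / ‖v‖₂`, and the
next one is the normalized component of `A v_j` orthogonal to all previous ones.  (If this
component is zero the process has broken down and the value is `0`.) -/
def arnoldiVec {n : ℕ} (A : Matrix (Fin n) (Fin n) ℂ) (v : EuclideanSpace ℂ (Fin n)) :
    ℕ → EuclideanSpace ℂ (Fin n)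
  | 0 => ((‖v‖ : ℂ)⁻¹) • v
  | j + 1 =>
    let Av : EuclideanSpace ℂ (Fin n) := Matrix.toEuclideanLin A (arnoldiVec A v j)
    let w : EuclideanSpace ℂ (Fin n) :=
      Av - ∑ i : Fin (j + 1), inner ℂ (arnoldiVec A v i) Av • arnoldiVec A v i
    ((‖w‖ : ℂ)⁻¹) • w
  termination_by j => j
  decreasing_by all_goals omega

/-- `V_m`: the matrix whose columns are the first `m` Arnoldi vectors. -/
def V {n : ℕ} (A : Matrix (Fin n) (Fin n) ℂ) (v : EuclideanSpace ℂ (Fin n)) (m : ℕ) :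
    Matrix (Fin n) (Fin m) ℂ :=
  Matrix.of fun i j => arnoldiVec A v j i

/-- `H_m = V_m^* A V_m`. -/
def H {n : ℕ} (A : Matrix (Fin n) (Fin n) ℂ) (v : EuclideanSpace ℂ (Fin n)) (m : ℕ) :
    Matrix (Fin m) (Fin m) ℂ :=
  (V A v m).conjTranspose * A * V A v m

/-- `h_{m+1,m}`: the last subdiagonal entry of `H_{m+1}` (this entry is real and nonnegative). -/
def h {n : ℕ} (A : Matrix (Fin n) (Fin n) ℂ) (v : EuclideanSpace ℂ (Fin n)) (m : ℕ) : ℝ :=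
  (H A v (m + 1) (Fin.last m) ⟨m - 1, by omega⟩).re

/-- `γ_m = ∏_{j=1}^{m-1} (H_m)_{j+1,j}`. -/
def gamma {n : ℕ} (A : Matrix (Fin n) (Fin n) ℂ) (v : EuclideanSpace ℂ (Fin n)) (m : ℕ) : ℂ :=
  ∏ j : Fin (m - 1), H A v m ⟨j + 1, by omega⟩ ⟨j, by omega⟩

/-- The scalar `e_m^* φ_q(s H_m) e_1`. -/
def phiEntry {n : ℕ} (A : Matrix (Fin n) (Fin n) ℂ) (v : EuclideanSpace ℂ (Fin n))
    {m : ℕ} (hm : 0 < m) (q : ℕ) (s : ℝ) : ℂ :=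
  phi q ((s : ℂ) • H A v m) ⟨m - 1, by omega⟩ ⟨0, hm⟩

/-- The error `l_{p,m}(t) = β V_m φ_p(t H_m) e_1 - φ_p(t A) v`, with `β = ‖v‖₂`. -/
def error {n : ℕ} (A : Matrix (Fin n) (Fin n) ℂ) (v : EuclideanSpace ℂ (Fin n))
    {m : ℕ} (hm : 0 < m) (p : ℕ) (t : ℝ) : EuclideanSpace ℂ (Fin n) :=
  WithLp.toLp 2
    ((‖v‖ : ℂ) • (V A v m).mulVec ((phi p ((t : ℂ) • H A v m)).mulVec (Pi.single ⟨0, hm⟩ 1))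
      - (phi p ((t : ℂ) • A)).mulVec (WithLp.ofLp v))

/-- The scalar defect `δ_{p,m}(s) = β e_m^* s^p φ_p(s H_m) e_1`. -/
def defect {n : ℕ} (A : Matrix (Fin n) (Fin n) ℂ) (v : EuclideanSpace ℂ (Fin n))
    {m : ℕ} (hm : 0 < m) (p : ℕ) (s : ℝ) : ℂ :=
  (‖v‖ : ℂ) * (s : ℂ) ^ p * phiEntry A v hm p s

/-- The defect integral `L_{p,m}(t) = (h_{m+1,m} / t^p) ∫_0^t |δ_{p,m}(s)| ds`. -/
def defectIntegral {n : ℕ} (A : Matrix (Fin n) (Fin n) ℂ) (v : EuclideanSpace ℂ (Fin n))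
    {m : ℕ} (hm : 0 < m) (p : ℕ) (t : ℝ) : ℝ :=
  h A v m / t ^ p * ∫ s in (0 : ℝ)..t, ‖defect A v hm p s‖

/-- The confluent divided difference `f[a₁, …, a_k, x]` of an analytic function `f`, by the Newton
recursion `f[x] = f x` and `f[a₁, …, a_k, x] = (f[a₁, …, a_{k-1}, x] - f[a₁, …, a_k]) / (x - a_k)`,
where the quotient is replaced by the derivative of `y ↦ f[a₁, …, a_{k-1}, y]` at `a_k`
if `x = a_k`. -/
def divDiffAux (f : ℂ → ℂ) : List ℂ → ℂ → ℂ
  | [], x => f x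
  | a :: l, x => divDiffAux (dslope f a) l x

/-- The confluent divided difference `f[a₁, …, a_m]` of an analytic function over `m ≥ 1` nodes. -/
def divDiff (f : ℂ → ℂ) {m : ℕ} (hm : 0 < m) (a : Fin m → ℂ) : ℂ :=
  divDiffAux f (List.ofFn fun j : Fin (m - 1) => a ⟨j, by omega⟩) (a ⟨m - 1, by omega⟩)

/-- The quantity `β h_{m+1,m} γ_m t (φ_{p+1})_t[ξ₁, …, ξ_m]`, where `ξ_j = Re λ_j` and
`(φ_{p+1})_t` is the function `z ↦ φ_{p+1}(t z)`. -/
def realPartBound {n : ℕ} (A : Matrix (Fin n) (Fin n) ℂ) (v : EuclideanSpace ℂ (Fin n))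
    {m : ℕ} (hm : 0 < m) (p : ℕ) (t : ℝ) (lam : Fin m → ℂ) : ℂ :=
  (‖v‖ : ℂ) * (h A v m : ℂ) * gamma A v m * (t : ℂ) *
    divDiff (fun z : ℂ => phi (p + 1) ((t : ℂ) * z)) hm (fun j => ((lam j).re : ℂ))

end Krylov

end

/-! The curve `Y(s) = s^p φ_p(sM)` solves `Y' = source · 1 + M Y`, and it is the derivative of the
same curve for `p + 1`, which vanishes at `0`. Both halves of the theorem rest on this.

Error bound (`norm_error_le`): by the Arnoldi relation the Krylov approximation, scaled by `s^p`,
solves the equation of `A` up to the residual `h δ(s) v_{m+1}`. The scaled error `e` starts at `0`,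
and since the numerical range lies in the closed left half-plane, `Re ⟨e, e'⟩ ≤ h |δ| ‖e‖`.
Integration and division by `t^p` give the bound.

Equalities: it suffices that `δ ≥ 0`, for then the modulus drops out and the integral is explicit.
Let `g_k` be the bottom-left entry of `(H - λ_1) ⋯ (H - λ_k) Y`. Then `g_k' = λ_{k+1} g_k + g_{k+1}`
plus `source` times the same entry of the bare product. As `H` is Hessenberg, that entry is `0` for
`k < m - 1` and `γ_m ≥ 0` for `k = m - 1`; by Cayley–Hamilton `g_m = 0`. With real `λ`, backward
induction on `k` yields `g_0 ≥ 0` (`mul_scaledPhi_apply_nonneg`). The same chain, applied to the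
Newton expansion of an entire function, shows that the entry is `γ_m` times the divided difference
(`IsMatrixFun.entry_eq_divDiffAux`). -/

noncomputable section
namespace Krylov
open Filter Topology

/-! ### The curves `s^p φ_p(sx)` in a Banach algebra -/

section Banach
/-- A series dominated termwise by an exponential series. -/
theorem summable_inv_factorial_mul_pow (p : ℕ) (r : ℝ) :
    Summable fun k : ℕ => ((k + p).factorial : ℝ)⁻¹ * |r| ^ k := by
  refine Summable.of_nonneg_of_le (fun k => by positivity) (fun k => ?_)
    (Real.summable_pow_div_factorial |r|)
  rw [div_eq_inv_mul]
  gcongr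
  omega

/-- The scaled function `s ^ p φ_p (s x)`. -/
def scaledPhi {𝔸 : Type*} [Semiring 𝔸] [Module ℂ 𝔸] [TopologicalSpace 𝔸]
    (p : ℕ) (x : 𝔸) (s : ℝ) : 𝔸 :=
  (s : ℂ) ^ p • phi p ((s : ℂ) • x)

/-- The factor `‖1‖` avoids assuming `‖1‖ = 1`, which fails for matrices of size `0`. -/
theorem norm_pow_le_mul {𝔸 : Type*} [NormedRing 𝔸] (x : 𝔸) (k : ℕ) : ‖x ^ k‖ ≤ ‖(1 : 𝔸)‖ * ‖x‖ ^ k := by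
  induction k with
  | zero => simp
  | succ k ih =>
    rw [pow_succ, pow_succ, ← mul_assoc]
    exact (norm_mul_le _ _).trans (by gcongr)

variable {𝔸 : Type*} [NormedRing 𝔸] [NormedAlgebra ℂ 𝔸]

theorem scaledPhi_succ_zero (p : ℕ) (x : 𝔸) : scaledPhi (p + 1) x 0 = 0 := by
  simp [scaledPhi]

variable [CompleteSpace 𝔸]

theorem summable_phi (p : ℕ) (x : 𝔸) :
    Summable fun k : ℕ => ((Nat.factorial (k + p) : ℂ)⁻¹) • x ^ k := by
  refine Summable.of_norm_bounded
    (g := fun k => ‖(1 : 𝔸)‖ * (((k + p).factorial : ℝ)⁻¹ * |‖x‖| ^ k))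
    ((summable_inv_factorial_mul_pow p ‖x‖).mul_left _) (fun k => ?_)
  rw [norm_smul, norm_inv, Complex.norm_natCast, abs_norm, mul_left_comm]
  gcongr
  exact norm_pow_le_mul x k

theorem phi_eq_add (p : ℕ) (x : 𝔸) :
    phi p x = ((Nat.factorial p : ℂ)⁻¹) • 1 + x * phi (p + 1) x := by
  unfold phi
  rw [(summable_phi p x).tsum_eq_zero_add, ← (summable_phi (p + 1) x).tsum_mul_left]
  congr 1
  · simp
  · refine tsum_congr fun k => ?_
    rw [mul_smul_comm, ← pow_succ', show k + 1 + p = k + (p + 1) by omega]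

theorem scaledPhi_eq_add (p : ℕ) (x : 𝔸) (s : ℝ) :
    scaledPhi p x s = ((s : ℂ) ^ p * (Nat.factorial p : ℂ)⁻¹) • 1 + x * scaledPhi (p + 1) x s := by
  unfold scaledPhi
  rw [phi_eq_add, smul_add, smul_smul, smul_mul_assoc, smul_smul, mul_smul_comm, pow_succ]

theorem scaledPhi_eq_tsum (p : ℕ) (x : 𝔸) (s : ℝ) :
    scaledPhi p x s = ∑' k : ℕ, ((s : ℂ) ^ (k + p) * (Nat.factorial (k + p) : ℂ)⁻¹) • x ^ k := by
  unfold scaledPhi phi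
  rw [← (summable_phi p _).tsum_const_smul]
  refine tsum_congr fun k => ?_
  rw [smul_pow, smul_smul, smul_smul]
  ring_nf

/-- Termwise differentiation lowers the exponent and the factorial together, so it only shifts `p`.
-/
theorem hasDerivAt_scaledPhi_succ (p : ℕ) (x : 𝔸) (s : ℝ) :
    HasDerivAt (scaledPhi (p + 1) x) (scaledPhi p x s) s := by
  have hfun : scaledPhi (p + 1) x = fun s : ℝ => ∑' k : ℕ,
      ((s : ℂ) ^ (k + (p + 1)) * (Nat.factorial (k + (p + 1)) : ℂ)⁻¹) • x ^ k :=
    funext fun s => scaledPhi_eq_tsum (p + 1) x s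
  rw [hfun, scaledPhi_eq_tsum]
  set R : ℝ := |s| + 1 with hR
  have hR0 : 0 ≤ R := by positivity
  -- The differentiated series is dominated uniformly on a ball containing `s`; at the base point
  -- `0` every term vanishes, because the exponents `k + p + 1` are positive.
  refine hasDerivAt_tsum_of_isPreconnected (F := 𝔸) (t := Metric.ball (0 : ℝ) R) (y₀ := 0)
    (g := fun k (s : ℝ) => ((s : ℂ) ^ (k + (p + 1)) * (Nat.factorial (k + (p + 1)) : ℂ)⁻¹) • x ^ k)
    (g' := fun k (s : ℝ) => ((s : ℂ) ^ (k + p) * (Nat.factorial (k + p) : ℂ)⁻¹) • x ^ k)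
    (u := fun k => ‖(1 : 𝔸)‖ * R ^ p * (((k + p).factorial : ℝ)⁻¹ * |R * ‖x‖| ^ k))
    ((summable_inv_factorial_mul_pow p _).mul_left _) Metric.isOpen_ball
    (convex_ball (0 : ℝ) R).isPreconnected (fun k y _ => ?_) (fun k y hy => ?_)
    (Metric.mem_ball_self (by positivity)) ?_ ?_
  · refine HasDerivAt.smul_const ?_ _
    have h1 := ((hasDerivAt_pow (k + p + 1) (y : ℂ)).comp_ofReal).mul_const
      ((Nat.factorial (k + (p + 1)) : ℂ)⁻¹)
    refine h1.congr_deriv ?_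
    rw [show k + (p + 1) = k + p + 1 by omega, Nat.factorial_succ]
    have : ((k + p).factorial : ℂ) ≠ 0 := by exact_mod_cast (k + p).factorial_ne_zero
    have h2 : ((k + p + 1 : ℕ) : ℂ) ≠ 0 := by exact_mod_cast Nat.succ_ne_zero (k + p)
    rw [Nat.add_sub_cancel, Nat.cast_mul]
    field_simp
  · have hy' : |y| ≤ R := by simpa using (Metric.mem_ball.1 hy).le
    rw [norm_smul, norm_mul, norm_inv, Complex.norm_natCast, norm_pow, Complex.norm_real,
      Real.norm_eq_abs, abs_of_nonneg (by positivity : 0 ≤ R * ‖x‖)]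
    calc |y| ^ (k + p) * ((k + p).factorial : ℝ)⁻¹ * ‖x ^ k‖
        ≤ R ^ (k + p) * ((k + p).factorial : ℝ)⁻¹ * (‖(1 : 𝔸)‖ * ‖x‖ ^ k) := by
          gcongr
          exact norm_pow_le_mul x k
      _ = ‖(1 : 𝔸)‖ * R ^ p * (((k + p).factorial : ℝ)⁻¹ * (R * ‖x‖) ^ k) := by rw [mul_pow, pow_add]; ring
  · refine summable_of_ne_finset_zero (s := ∅) (fun k _ => ?_)
    simp
  · simp [hR]

theorem scaledPhi_zero_zero (x : 𝔸) : scaledPhi 0 x 0 = 1 := by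
  rw [scaledPhi_eq_add, scaledPhi_succ_zero]
  simp

/-- The source term of the differential equation of `scaledPhi`. -/
def source : ℕ → ℝ → ℝ
  | 0, _ => 0
  | p + 1, s => s ^ p * (Nat.factorial p : ℝ)⁻¹

theorem source_nonneg (p : ℕ) {s : ℝ} (hs : 0 ≤ s) : 0 ≤ source p s := by
  cases p <;> simp only [source] <;> positivity

/-- For `p ≥ 1` the derivative is the curve of index `p - 1`, rewritten by the recurrence. For `p =
0` there is no lower index, and the recurrence itself is differentiated. -/
theorem hasDerivAt_scaledPhi (p : ℕ) (x : 𝔸) (s : ℝ) :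
    HasDerivAt (scaledPhi p x) ((source p s : ℂ) • 1 + x * scaledPhi p x s) s := by
  cases p with
  | zero =>
    have hfun : scaledPhi 0 x = fun s => 1 + x * scaledPhi 1 x s := by
      funext s
      rw [scaledPhi_eq_add]
      simp
    have := ((hasDerivAt_scaledPhi_succ 0 x s).const_mul x).const_add 1
    rw [← hfun] at this
    simpa [source] using this
  | succ p =>
    have := hasDerivAt_scaledPhi_succ p x s
    rw [scaledPhi_eq_add] at this
    simpa [source] using this

theorem hasSum_phi_smul (p : ℕ) (x : 𝔸) (t : ℂ) :
    HasSum (fun k : ℕ => (t ^ k * (Nat.factorial (k + p) : ℂ)⁻¹) • x ^ k) (phi p (t • x)) := by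
  have := (summable_phi p (t • x)).hasSum
  refine this.congr_fun fun k => ?_
  rw [smul_pow, smul_smul, mul_comm]

end Banach

/-! ### Matrix and entrywise forms -/

section Mat
variable {m : ℕ}
open scoped Matrix.Norms.Operator

theorem hasDerivAt_scaledPhi_matrix_succ_apply (p : ℕ) (M : Matrix (Fin m) (Fin m) ℂ) (s : ℝ)
    (i j : Fin m) : HasDerivAt (fun s => scaledPhi (p + 1) M s i j) (scaledPhi p M s i j) s :=
  hasDerivAt_pi.1 (hasDerivAt_pi.1 (hasDerivAt_scaledPhi_succ p M s) i) j

theorem hasDerivAt_scaledPhi_matrix_apply (p : ℕ) (M : Matrix (Fin m) (Fin m) ℂ) (s : ℝ)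
    (i j : Fin m) : HasDerivAt (fun s => scaledPhi p M s i j)
      (((source p s : ℂ) • (1 : Matrix (Fin m) (Fin m) ℂ) + M * scaledPhi p M s) i j) s :=
  hasDerivAt_pi.1 (hasDerivAt_pi.1 (hasDerivAt_scaledPhi p M s) i) j

theorem scaledPhi_matrix_succ_zero (p : ℕ) (M : Matrix (Fin m) (Fin m) ℂ) :
    scaledPhi (p + 1) M 0 = 0 := scaledPhi_succ_zero p M

theorem scaledPhi_matrix_zero_zero (M : Matrix (Fin m) (Fin m) ℂ) :
    scaledPhi 0 M 0 = 1 := scaledPhi_zero_zero M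

theorem hasSum_phi_matrix_smul (p : ℕ) (M : Matrix (Fin m) (Fin m) ℂ) (t : ℂ) :
    HasSum (fun k : ℕ => (t ^ k * (Nat.factorial (k + p) : ℂ)⁻¹) • M ^ k) (phi p (t • M)) :=
  hasSum_phi_smul p M t

end Mat

/-! ### Entire functions of a matrix and their Newton form -/

/-- Coefficients of an everywhere convergent power series are determined by its sum. -/
theorem hasSum_pow_coeff_unique {c d : ℕ → ℂ} {f : ℂ → ℂ}
    (hc : ∀ z, HasSum (fun k => c k * z ^ k) (f z))
    (hd : ∀ z, HasSum (fun k => d k * z ^ k) (f z)) : c = d := by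
  have key : ∀ c : ℕ → ℂ, (∀ z, HasSum (fun k => c k * z ^ k) (f z)) →
      HasFPowerSeriesAt f (FormalMultilinearSeries.ofScalars ℂ c) 0 := by
    intro c hc
    refine ⟨1, ?_, by norm_num, fun {y} _ => ?_⟩
    · have h1 : Summable fun k => ‖FormalMultilinearSeries.ofScalars ℂ c k‖ * ((1 : NNReal) : ℝ) ^ k := by
        have := (hc 1).summable.norm
        simpa [FormalMultilinearSeries.ofScalars_norm] using this
      simpa using FormalMultilinearSeries.le_radius_of_summable _ h1
    · simpa [FormalMultilinearSeries.ofScalars_apply_eq, mul_comm] using hc y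
  exact FormalMultilinearSeries.ofScalars_series_injective ℂ ℂ
    ((key c hc).eq_formalMultilinearSeries (key d hd))

/-- `F` is the value at the matrix `M` of the entire function `f`. -/
def IsMatrixFun {m : ℕ} (M : Matrix (Fin m) (Fin m) ℂ) (f : ℂ → ℂ)
    (F : Matrix (Fin m) (Fin m) ℂ) : Prop :=
  ∃ c : ℕ → ℂ, (∀ z, HasSum (fun k => c k * z ^ k) (f z)) ∧ HasSum (fun k => c k • M ^ k) F

section
variable {m : ℕ} {M : Matrix (Fin m) (Fin m) ℂ}

-- The Taylor series at `0` converges absolutely at the scalar `‖M‖`, which dominates the matrix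
-- series.
open scoped Matrix.Norms.Operator in
theorem exists_isMatrixFun_of_differentiable {f : ℂ → ℂ} (hf : Differentiable ℂ f) :
    ∃ F, IsMatrixFun M f F := by
  have h1 : ∀ z, HasSum (fun k => ((k.factorial : ℂ)⁻¹ * iteratedDeriv k f 0) * z ^ k) (f z) := by
    intro z
    have := Complex.hasSum_taylorSeries_of_entire hf 0 z
    refine this.congr_fun fun k => ?_
    simp only [sub_zero, smul_eq_mul]
    ring
  refine ⟨_, _, h1, Summable.hasSum ?_⟩
  have h2 := ((h1 (‖M‖ : ℂ)).summable.norm).mul_left ‖(1 : Matrix (Fin m) (Fin m) ℂ)‖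
  refine Summable.of_norm_bounded h2 fun k => ?_
  rw [norm_smul, norm_mul _ ((‖M‖ : ℂ) ^ k), norm_pow (‖M‖ : ℂ), Complex.norm_real, norm_norm,
    mul_left_comm]
  gcongr
  exact norm_pow_le_mul M k

theorem IsMatrixFun.differentiable {f : ℂ → ℂ} {F} (h : IsMatrixFun M f F) :
    Differentiable ℂ f := by
  obtain ⟨c, hc, -⟩ := h
  intro z
  have h1 : HasFPowerSeriesOnBall f (FormalMultilinearSeries.ofScalars ℂ c) 0 ⊤ := by
    refine ⟨?_, by norm_num, fun {y} _ => ?_⟩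
    · rw [top_le_iff]
      refine ENNReal.eq_top_of_forall_nnreal_le fun r => ?_
      refine FormalMultilinearSeries.le_radius_of_summable _ ?_
      have := (hc (r : ℝ)).summable.norm
      simpa [FormalMultilinearSeries.ofScalars_norm] using this
    · simpa [FormalMultilinearSeries.ofScalars_apply_eq, mul_comm] using hc y
  exact h1.differentiableOn.differentiableAt (by simp)

/-- Multiplication of a power series by `x - a`. -/
theorem hasSum_shift_sub {R : Type*} [Ring R] [Algebra ℂ R] [TopologicalSpace R]
    [IsTopologicalRing R] [ContinuousConstSMul ℂ R] {d : ℕ → ℂ} (w a : ℂ) {x g : R}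
    (hg : HasSum (fun k => d k • x ^ k) g) :
    HasSum (fun k => (Nat.casesOn k (w - a * d 0) fun k => d k - a * d (k + 1) : ℂ) • x ^ k)
      (w • 1 + (x - a • 1) * g) := by
  have h1 : HasSum (fun k => d k • x ^ (k + 1)) (x * g) := by
    refine (hg.mul_left x).congr_fun fun k => ?_
    rw [mul_smul_comm, ← pow_succ']
  have h2 : HasSum (fun k => d (k + 1) • x ^ (k + 1)) (g - d 0 • 1) := by
    have := (hasSum_nat_add_iff' 1).2 hg
    simpa using this
  have h3 := h1.sub (h2.const_smul a)
  rw [← hasSum_nat_add_iff' 1]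
  convert h3 using 1
  · funext k
    simp only [sub_smul, smul_smul]
  · rw [Finset.sum_range_one, pow_zero]
    change w • 1 + (x - a • 1) * g - (w - a * d 0) • (1 : R) = _
    simp only [sub_smul, smul_sub, sub_mul, smul_mul_assoc, one_mul, smul_smul]
    abel

/-- The scalar identity `f z = f a + (z - a) * dslope f a z` is an identity of power series;
uniqueness of coefficients carries it over to `M`. -/
theorem IsMatrixFun.eq_add {f : ℂ → ℂ} {F G} {a : ℂ} (hF : IsMatrixFun M f F)
    (hG : IsMatrixFun M (dslope f a) G) :
    F = f a • 1 + (M - a • 1) * G := by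
  obtain ⟨c, hc, hcF⟩ := hF
  obtain ⟨d, hd, hdG⟩ := hG
  have hb : ∀ z, HasSum (fun k =>
      (Nat.casesOn k (f a - a * d 0) fun k => d k - a * d (k + 1) : ℂ) * z ^ k) (f z) := by
    intro z
    have h : HasSum _ (f a • (1 : ℂ) + (z - a • 1) * dslope f a z) :=
      hasSum_shift_sub (f a) a (hd z)
    have h6 : f a • 1 + (z - a • 1) * dslope f a z = f z := by
      have := sub_smul_dslope f a z
      simp only [smul_eq_mul, mul_one] at this ⊢
      rw [this]
      ring
    rwa [h6] at h
  have hcb := hasSum_pow_coeff_unique hc hb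
  subst hcb
  exact hcF.unique (hasSum_shift_sub (f a) a hdG)

/-- The factor `(M - a₁) ⋯ (M - a_k)` of the Newton form. -/
def nodeProd (M : Matrix (Fin m) (Fin m) ℂ) (l : List ℂ) : Matrix (Fin m) (Fin m) ℂ :=
  (l.map fun a => M - a • 1).prod

theorem nodeProd_cons (a : ℂ) (l : List ℂ) :
    nodeProd M (a :: l) = (M - a • 1) * nodeProd M l := by
  simp [nodeProd]

/-- One Newton step per node: `Q` absorbs the factors already split off. The term `f a • Q` has zero
entry until the last node, where the remainder is killed by `hQ` and only the divided difference
survives. -/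
theorem IsMatrixFun.entry_eq_divDiffAux {f : ℂ → ℂ} {F : Matrix (Fin m) (Fin m) ℂ}
    (hF : IsMatrixFun M f F) (i j : Fin m) (l : List ℂ) (x : ℂ)
    (Q : Matrix (Fin m) (Fin m) ℂ) (hQ : Q * nodeProd M (l ++ [x]) = 0)
    (hz : ∀ l' b l'', l = l' ++ b :: l'' → (Q * nodeProd M l') i j = 0) :
    (Q * F) i j = (Q * nodeProd M l) i j * divDiffAux f l x := by
  induction l generalizing f F Q with
  | nil =>
    obtain ⟨G, hG⟩ := exists_isMatrixFun_of_differentiable (M := M)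
      ((Complex.differentiableOn_dslope (c := x) univ_mem).2
        hF.differentiable.differentiableOn |> differentiableOn_univ.1)
    rw [hF.eq_add hG, mul_add, ← mul_assoc]
    have : Q * (M - x • 1) = 0 := by simpa [nodeProd] using hQ
    rw [this]
    simp [nodeProd, divDiffAux, mul_comm]
  | cons a l ih =>
    obtain ⟨G, hG⟩ := exists_isMatrixFun_of_differentiable (M := M)
      ((Complex.differentiableOn_dslope (c := a) univ_mem).2
        hF.differentiable.differentiableOn |> differentiableOn_univ.1)
    rw [hF.eq_add hG, mul_add, ← mul_assoc]
    have h0 : Q i j = 0 := by simpa [nodeProd] using hz [] a l rfl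
    have h1 := ih hG (Q * (M - a • 1))
      (by rw [mul_assoc, ← nodeProd_cons]; simpa using hQ)
      (fun l' b l'' h => by
        rw [mul_assoc, ← nodeProd_cons]
        exact hz (a :: l') b l'' (by simp [h]))
    rw [Matrix.add_apply, h1, mul_assoc Q, ← nodeProd_cons]
    simp [h0, divDiffAux]

/-- A product of shifted Hessenberg matrices moves the first unit vector down by at most one index
per factor. -/
theorem nodeProd_apply_of_hessenberg (hm : 0 < m)
    (hM : ∀ i j : Fin m, (j : ℕ) + 1 < i → M i j = 0) (l : List ℂ) :
    (∀ i : Fin m, l.length < i → nodeProd M l i ⟨0, hm⟩ = 0) ∧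
    ∀ hl : l.length < m, nodeProd M l ⟨l.length, hl⟩ ⟨0, hm⟩ =
      ∏ k : Fin l.length, M ⟨k + 1, by omega⟩ ⟨k, by omega⟩ := by
  induction l with
  | nil =>
    refine ⟨fun i hi => ?_, fun hl => ?_⟩
    · simp only [nodeProd, List.map_nil, List.prod_nil]
      refine Matrix.one_apply_ne fun h => ?_
      simp [h] at hi
    · simp [nodeProd]
  | cons a l ih =>
    obtain ⟨ih1, ih2⟩ := ih
    refine ⟨fun i hi => ?_, fun hl => ?_⟩
    · rw [nodeProd_cons, Matrix.mul_apply]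
      refine Finset.sum_eq_zero fun k _ => ?_
      simp only [List.length_cons] at hi
      by_cases hk : l.length < k
      · rw [ih1 k hk, mul_zero]
      · have h1 : M i k = 0 := hM i k (by omega)
        have h2 : i ≠ k := fun h => by omega
        simp [h1, Matrix.one_apply_ne h2]
    · simp only [List.length_cons] at hl
      rw [nodeProd_cons, Matrix.mul_apply, Finset.sum_eq_single ⟨l.length, by omega⟩]
      · rw [ih2 (by omega)]
        simp only [List.length_cons, Fin.prod_univ_castSucc, Fin.val_castSucc, Fin.val_last]
        rw [mul_comm]
        congr 1
        rw [Matrix.sub_apply, Matrix.smul_apply, Matrix.one_apply_ne (by simp), smul_zero, sub_zero]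
      · intro k _ hk
        by_cases hk' : l.length < k
        · rw [ih1 k hk', mul_zero]
        · have hk2 : (k : ℕ) ≠ l.length := fun h => hk (Fin.ext h)
          have h1 : M ⟨(a :: l).length, hl⟩ k = 0 := hM _ k (by simp only [List.length_cons]; omega)
          have h2 : (⟨(a :: l).length, hl⟩ : Fin m) ≠ k := fun h => by
            have := congrArg Fin.val h
            simp at this
            omega
          rw [Matrix.sub_apply, Matrix.smul_apply, h1, Matrix.one_apply_ne h2]
          simp
      · simp

/-- Cayley–Hamilton; the product is turned into a list product before it is mapped to the
noncommutative matrix ring. -/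
theorem nodeProd_eq_zero_of_charpoly {lam : Fin m → ℂ}
    (hlam : M.charpoly = ∏ j, (Polynomial.X - Polynomial.C (lam j))) :
    nodeProd M (List.ofFn lam) = 0 := by
  have := M.aeval_self_charpoly
  rw [hlam, ← List.prod_ofFn, map_list_prod, List.map_ofFn] at this
  rw [nodeProd, List.map_ofFn, ← this]
  congr 2
  funext j
  simp [Algebra.algebraMap_eq_smul_one]

/-! ### Positivity of the bottom-left entry -/

/-- The integrating factor `exp (-lam * s)` makes `g` nondecreasing on `[0, ∞)`. -/
theorem nonneg_of_mul_le_hasDerivAt {g g' : ℝ → ℝ} {lam : ℝ}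
    (hg : ∀ s, HasDerivAt g (g' s) s) (h0 : 0 ≤ g 0)
    (hle : ∀ s, 0 ≤ s → lam * g s ≤ g' s) {s : ℝ} (hs : 0 ≤ s) : 0 ≤ g s := by
  have hd : ∀ s, HasDerivAt (fun s => Real.exp (-lam * s) * g s)
      (Real.exp (-lam * s) * (g' s - lam * g s)) s := by
    intro s
    have h1 : HasDerivAt (fun s : ℝ => -lam * s) (-lam) s := by
      simpa using (hasDerivAt_id s).const_mul (-lam)
    exact (h1.exp.mul (hg s)).congr_deriv (by ring)
  have hmono : MonotoneOn (fun s => Real.exp (-lam * s) * g s) (Set.Ici 0) := by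
    refine monotoneOn_of_deriv_nonneg (convex_Ici 0)
      (fun s _ => (hd s).continuousAt.continuousWithinAt)
      (fun s _ => (hd s).differentiableAt.differentiableWithinAt) fun s hs => ?_
    rw [(hd s).deriv]
    rw [interior_Ici] at hs
    exact mul_nonneg (Real.exp_pos _).le (sub_nonneg.2 (hle s (Set.mem_Ioi.1 hs).le))
  have h2 := hmono (Set.mem_Ici.2 le_rfl) (Set.mem_Ici.2 hs) hs
  simp only [mul_zero, Real.exp_zero, one_mul] at h2
  exact nonneg_of_mul_nonneg_right (h0.trans h2) (Real.exp_pos _)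

end

-- In the complex order `0 ≤ z` also says that `z` is real. The imaginary part solves a homogeneous
-- linear equation from `0`, so the real lemma applied to it and to its negative makes it vanish.
open scoped ComplexOrder in
theorem nonneg_of_hasDerivAt_complex {g g' : ℝ → ℂ} {lam : ℝ}
    (hg : ∀ s, HasDerivAt g (g' s) s) (h0 : 0 ≤ g 0)
    (hle : ∀ s, 0 ≤ s → 0 ≤ g' s - lam * g s) {s : ℝ} (hs : 0 ≤ s) : 0 ≤ g s := by
  have hre : ∀ s, HasDerivAt (fun s => (g s).re) (g' s).re s := fun s =>
    (Complex.reCLM.hasFDerivAt.comp_hasDerivAt s (hg s))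
  have him : ∀ s, HasDerivAt (fun s => (g s).im) (g' s).im s := fun s =>
    (Complex.imCLM.hasFDerivAt.comp_hasDerivAt s (hg s))
  rw [Complex.nonneg_iff] at h0 ⊢
  have h2 : ∀ s, 0 ≤ s → lam * (g s).re ≤ (g' s).re ∧ (g' s).im = lam * (g s).im := by
    intro s hs
    have := Complex.nonneg_iff.1 (hle s hs)
    simp only [Complex.sub_re, Complex.sub_im, Complex.mul_re, Complex.mul_im, Complex.ofReal_re,
      Complex.ofReal_im, zero_mul, sub_zero, add_zero] at this
    exact ⟨by linarith [this.1], by linarith [this.2]⟩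
  refine ⟨nonneg_of_mul_le_hasDerivAt hre h0.1 (fun s hs => (h2 s hs).1) hs, ?_⟩
  have h3 := nonneg_of_mul_le_hasDerivAt him h0.2.le (fun s hs => (h2 s hs).2.ge) hs
  have h4 := nonneg_of_mul_le_hasDerivAt (lam := lam) (fun s => (him s).neg)
    (by simp [← h0.2]) (fun s hs => by
      rw [(h2 s hs).2]
      simp) hs
  simp only [Pi.neg_apply] at h4
  linarith

section
variable {m : ℕ} {M : Matrix (Fin m) (Fin m) ℂ}

theorem hasDerivAt_mul_scaledPhi_apply (p : ℕ) (Q : Matrix (Fin m) (Fin m) ℂ) (a : ℂ) (s : ℝ)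
    (i j : Fin m) : HasDerivAt (fun s => (Q * scaledPhi p M s) i j)
      (source p s * Q i j + a * (Q * scaledPhi p M s) i j +
        (Q * (M - a • 1) * scaledPhi p M s) i j) s := by
  have h1 : HasDerivAt (fun s => ∑ k, Q i k * scaledPhi p M s k j) _ s :=
    HasDerivAt.fun_sum fun k _ =>
      (hasDerivAt_scaledPhi_matrix_apply p M s k j).const_mul (Q i k)
  simp only [← Matrix.mul_apply] at h1
  refine h1.congr_deriv ?_
  -- Here `Q M = a Q + Q (M - a)`: the next node is split off.
  rw [mul_add, ← mul_assoc, mul_sub, sub_mul]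
  simp

open scoped ComplexOrder in
theorem mul_scaledPhi_apply_nonneg (p : ℕ) (i j : Fin m) (l : List ℂ) (x : ℂ)
    (hl : ∀ a ∈ l, a.im = 0) (hx : x.im = 0)
    (Q : Matrix (Fin m) (Fin m) ℂ) (hQ : Q * nodeProd M (l ++ [x]) = 0)
    (hz : ∀ l' b l'', l = l' ++ b :: l'' → (Q * nodeProd M l') i j = 0)
    (hpos : 0 ≤ (Q * nodeProd M l) i j) {s : ℝ} (hs : 0 ≤ s) :
    0 ≤ (Q * scaledPhi p M s) i j := by
  -- The initial value is `Q` for `p = 0` and `0` otherwise. This fact depends on `Q`, so the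
  -- induction hypothesis asks for it again.
  have hinit : 0 ≤ Q i j → 0 ≤ (Q * scaledPhi p M 0) i j := by
    intro h
    cases p with
    | zero => simpa [scaledPhi_matrix_zero_zero] using h
    | succ p => simp [scaledPhi_matrix_succ_zero]
  induction l generalizing Q s with
  | nil =>
    have hx' : x = (x.re : ℂ) := Complex.ext rfl (by simpa using hx)
    have h0 : 0 ≤ Q i j := by simpa [nodeProd] using hpos
    refine nonneg_of_hasDerivAt_complex (lam := x.re)
      (fun s => hasDerivAt_mul_scaledPhi_apply p Q x s i j) (hinit h0) (fun s hs => ?_) hs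
    have h1 : Q * (M - x • 1) = 0 := by simpa [nodeProd] using hQ
    rw [h1, ← hx']
    simp only [zero_mul, Matrix.zero_apply, add_zero, add_sub_cancel_right]
    exact mul_nonneg (Complex.zero_le_real.2 (source_nonneg p hs)) h0
  | cons a l ih =>
    have ha : a.im = 0 := hl a (by simp)
    have ha' : a = (a.re : ℂ) := Complex.ext rfl (by simpa using ha)
    have h0 : Q i j = 0 := by simpa [nodeProd] using hz [] a l rfl
    -- The source drops out because `Q i j = 0`; what drives `g` is the entry with one more factor,
    -- nonnegative by induction.
    refine nonneg_of_hasDerivAt_complex (lam := a.re)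
      (fun s => hasDerivAt_mul_scaledPhi_apply p Q a s i j) (hinit h0.ge) (fun s hs => ?_) hs
    rw [← ha', h0, mul_zero, zero_add, add_sub_cancel_left]
    refine ih (fun b hb => hl b (by simp [hb])) (Q * (M - a • 1))
      (by rw [mul_assoc, ← nodeProd_cons]; simpa using hQ)
      (fun l' b l'' h => ?_) ?_ hs ?_
    · rw [mul_assoc, ← nodeProd_cons]
      exact hz (a :: l') b l'' (by simp [h])
    · rwa [mul_assoc, ← nodeProd_cons]
    · intro h
      cases p with
      | zero => simpa [scaledPhi_matrix_zero_zero] using h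
      | succ p => simp [scaledPhi_matrix_succ_zero]

/-- The nodes but the last. -/
def initNodes (lam : Fin m → ℂ) : List ℂ := List.ofFn fun j : Fin (m - 1) => lam ⟨j, by omega⟩

theorem length_initNodes (lam : Fin m → ℂ) : (initNodes lam).length = m - 1 := by
  simp [initNodes]

theorem ofFn_eq_initNodes_append (hm : 0 < m) (lam : Fin m → ℂ) :
    List.ofFn lam = initNodes lam ++ [lam ⟨m - 1, by omega⟩] := by
  obtain ⟨k, rfl⟩ : ∃ k, m = k + 1 := ⟨m - 1, by omega⟩
  rw [List.ofFn_succ', List.concat_eq_append]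
  rfl

theorem nodeProd_initNodes_append (hm : 0 < m) {lam : Fin m → ℂ}
    (hlam : M.charpoly = ∏ j, (Polynomial.X - Polynomial.C (lam j))) :
    nodeProd M (initNodes lam ++ [lam ⟨m - 1, by omega⟩]) = 0 := by
  rw [← ofFn_eq_initNodes_append hm, nodeProd_eq_zero_of_charpoly hlam]

/-- A proper prefix has fewer than `m - 1` factors, too few to reach the last row. -/
theorem nodeProd_prefix_apply (hm : 0 < m)
    (hM : ∀ i j : Fin m, (j : ℕ) + 1 < i → M i j = 0) (lam : Fin m → ℂ) (l' : List ℂ) (b : ℂ)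
    (l'' : List ℂ) (h : initNodes lam = l' ++ b :: l'') :
    nodeProd M l' ⟨m - 1, by omega⟩ ⟨0, hm⟩ = 0 := by
  refine (nodeProd_apply_of_hessenberg hm hM l').1 _ ?_
  have := congrArg List.length h
  simp only [length_initNodes, List.length_append, List.length_cons] at this
  simp only
  omega

theorem nodeProd_initNodes_apply (hm : 0 < m)
    (hM : ∀ i j : Fin m, (j : ℕ) + 1 < i → M i j = 0) (lam : Fin m → ℂ) :
    nodeProd M (initNodes lam) ⟨m - 1, by omega⟩ ⟨0, hm⟩ =
      ∏ j : Fin (m - 1), M ⟨j + 1, by omega⟩ ⟨j, by omega⟩ := by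
  have hl := length_initNodes lam
  have h := (nodeProd_apply_of_hessenberg hm hM (initNodes lam)).2 (by omega)
  have h2 : (⟨(initNodes lam).length, by omega⟩ : Fin m) = ⟨m - 1, by omega⟩ := Fin.ext hl
  rw [h2] at h
  rw [h]
  exact Fintype.prod_equiv (finCongr hl) _ _ fun k => rfl

theorem IsMatrixFun.apply_eq_mul_divDiff (hm : 0 < m)
    (hM : ∀ i j : Fin m, (j : ℕ) + 1 < i → M i j = 0) {lam : Fin m → ℂ}
    (hlam : M.charpoly = ∏ j, (Polynomial.X - Polynomial.C (lam j)))
    {f : ℂ → ℂ} {F : Matrix (Fin m) (Fin m) ℂ} (hF : IsMatrixFun M f F) :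
    F ⟨m - 1, by omega⟩ ⟨0, hm⟩ =
      (∏ j : Fin (m - 1), M ⟨j + 1, by omega⟩ ⟨j, by omega⟩) * divDiff f hm lam := by
  have h := hF.entry_eq_divDiffAux ⟨m - 1, by omega⟩ ⟨0, hm⟩ (initNodes lam) _ 1
    (by rw [one_mul, nodeProd_initNodes_append hm hlam])
    (fun l' b l'' h => by rw [one_mul]; exact nodeProd_prefix_apply hm hM lam l' b l'' h)
  rwa [one_mul, one_mul, nodeProd_initNodes_apply hm hM] at h

open scoped ComplexOrder in
theorem scaledPhi_apply_nonneg (hm : 0 < m)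
    (hM : ∀ i j : Fin m, (j : ℕ) + 1 < i → M i j = 0) {lam : Fin m → ℂ}
    (hlam : M.charpoly = ∏ j, (Polynomial.X - Polynomial.C (lam j)))
    (hreal : ∀ j, (lam j).im = 0)
    (hpos : ∀ j : Fin (m - 1), 0 ≤ M ⟨j + 1, by omega⟩ ⟨j, by omega⟩)
    (p : ℕ) {s : ℝ} (hs : 0 ≤ s) :
    0 ≤ scaledPhi p M s ⟨m - 1, by omega⟩ ⟨0, hm⟩ := by
  have h := mul_scaledPhi_apply_nonneg (M := M) p ⟨m - 1, by omega⟩ ⟨0, hm⟩ (initNodes lam)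
    (lam ⟨m - 1, by omega⟩)
    (fun a ha => by
      obtain ⟨j, rfl⟩ := List.mem_ofFn.1 ha
      exact hreal _)
    (hreal _) 1
    (by rw [one_mul, nodeProd_initNodes_append hm hlam])
    (fun l' b l'' h => by rw [one_mul]; exact nodeProd_prefix_apply hm hM lam l' b l'' h)
    (by
      rw [one_mul, nodeProd_initNodes_apply hm hM]
      exact Finset.prod_nonneg fun j _ => hpos j) hs
  rwa [one_mul] at h

theorem isMatrixFun_phi (p : ℕ) (t : ℂ) :
    IsMatrixFun M (fun z => phi p (t * z)) (phi p (t • M)) :=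
  ⟨fun k => t ^ k * (Nat.factorial (k + p) : ℂ)⁻¹, fun z => hasSum_phi_smul p z t,
    hasSum_phi_matrix_smul p M t⟩

end

/-! ### The Arnoldi process -/

section Arnoldi
variable {n : ℕ} (A : Matrix (Fin n) (Fin n) ℂ) (v : EuclideanSpace ℂ (Fin n))

/-- The component of `A v_j` orthogonal to the Arnoldi vectors produced so far. -/
def arnoldiResidual (j : ℕ) : EuclideanSpace ℂ (Fin n) :=
  Matrix.toEuclideanLin A (arnoldiVec A v j) - ∑ i : Fin (j + 1),
    inner ℂ (arnoldiVec A v i) (Matrix.toEuclideanLin A (arnoldiVec A v j)) • arnoldiVec A v i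

theorem arnoldiVec_zero : arnoldiVec A v 0 = ((‖v‖ : ℂ)⁻¹) • v := by
  rw [arnoldiVec]

theorem arnoldiVec_succ (j : ℕ) :
    arnoldiVec A v (j + 1) = ((‖arnoldiResidual A v j‖ : ℂ)⁻¹) • arnoldiResidual A v j := by
  rw [arnoldiVec]
  rfl

theorem norm_smul_inv_norm_smul {E : Type*} [NormedAddCommGroup E] [NormedSpace ℂ E] (w : E) :
    (‖w‖ : ℂ) • ((‖w‖ : ℂ)⁻¹) • w = w := by
  by_cases hw : w = 0
  · simp [hw]
  · rw [smul_smul, mul_inv_cancel₀ (by simpa using hw), one_smul]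

theorem norm_smul_arnoldiVec_zero : (‖v‖ : ℂ) • arnoldiVec A v 0 = v := by
  rw [arnoldiVec_zero, norm_smul_inv_norm_smul]

theorem norm_smul_arnoldiVec_succ (j : ℕ) :
    (‖arnoldiResidual A v j‖ : ℂ) • arnoldiVec A v (j + 1) = arnoldiResidual A v j := by
  rw [arnoldiVec_succ, norm_smul_inv_norm_smul]

theorem norm_arnoldiVec (j : ℕ) : ‖arnoldiVec A v j‖ = 1 ∨ arnoldiVec A v j = 0 := by
  have key : ∀ w : EuclideanSpace ℂ (Fin n),
      ‖((‖w‖ : ℂ)⁻¹) • w‖ = 1 ∨ ((‖w‖ : ℂ)⁻¹) • w = 0 := by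
    intro w
    by_cases hw : w = 0
    · simp [hw]
    · left
      rw [norm_smul, norm_inv, Complex.norm_real, norm_norm, inv_mul_cancel₀ (by simpa using hw)]
  cases j with
  | zero => rw [arnoldiVec_zero]; exact key v
  | succ j => rw [arnoldiVec_succ]; exact key _

/-- Each earlier vector is a unit vector or zero, so subtracting the projections removes exactly the
components along them, even after a breakdown. -/
theorem inner_arnoldiVec_of_lt {i j : ℕ} (hij : i < j) :
    inner ℂ (arnoldiVec A v i) (arnoldiVec A v j) = 0 := by
  induction j using Nat.strong_induction_on generalizing i with
  | _ j ih =>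
    obtain ⟨j, rfl⟩ : ∃ k, j = k + 1 := ⟨j - 1, by omega⟩
    rw [arnoldiVec_succ, inner_smul_right]
    refine mul_eq_zero_of_right _ ?_
    rw [arnoldiResidual, inner_sub_right, inner_sum,
      Finset.sum_eq_single (⟨i, hij⟩ : Fin (j + 1))]
    · rw [inner_smul_right]
      rcases norm_arnoldiVec A v i with h | h
      · rw [inner_self_eq_norm_sq_to_K, h]; simp
      · simp [h]
    · intro k _ hk
      have hk' : (k : ℕ) ≠ i := fun h => hk (Fin.ext h)
      rw [inner_smul_right]
      rcases lt_or_gt_of_ne hk' with h | h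
      · rw [← inner_conj_symm (arnoldiVec A v i) (arnoldiVec A v k), ih i hij h]; simp
      · rw [ih k k.2 h]; simp
    · simp

theorem inner_arnoldiVec_of_ne {i j : ℕ} (hij : i ≠ j) :
    inner ℂ (arnoldiVec A v i) (arnoldiVec A v j) = 0 := by
  rcases lt_or_gt_of_ne hij with h | h
  · exact inner_arnoldiVec_of_lt A v h
  · rw [← inner_conj_symm, inner_arnoldiVec_of_lt A v h, map_zero]

/-- The Hessenberg entry `v_i^* A v_j`. -/
def arnoldiCoeff (i j : ℕ) : ℂ :=
  inner ℂ (arnoldiVec A v i) (Matrix.toEuclideanLin A (arnoldiVec A v j))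

theorem map_arnoldiVec (j : ℕ) : Matrix.toEuclideanLin A (arnoldiVec A v j) =
    (∑ i ∈ Finset.range (j + 1), arnoldiCoeff A v i j • arnoldiVec A v i) +
      (‖arnoldiResidual A v j‖ : ℂ) • arnoldiVec A v (j + 1) := by
  rw [norm_smul_arnoldiVec_succ, arnoldiResidual, Finset.sum_range]
  simp only [arnoldiCoeff]
  abel

theorem arnoldiCoeff_of_lt {i j : ℕ} (h : j + 1 < i) : arnoldiCoeff A v i j = 0 := by
  rw [arnoldiCoeff, map_arnoldiVec, inner_add_right, inner_sum, inner_smul_right,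
    inner_arnoldiVec_of_ne A v h.ne', mul_zero, add_zero]
  refine Finset.sum_eq_zero fun k hk => ?_
  rw [Finset.mem_range] at hk
  rw [inner_smul_right, inner_arnoldiVec_of_ne A v (by omega), mul_zero]

theorem arnoldiCoeff_succ (j : ℕ) :
    arnoldiCoeff A v (j + 1) j = (‖arnoldiResidual A v j‖ : ℂ) := by
  rw [arnoldiCoeff, map_arnoldiVec, inner_add_right, inner_sum, inner_smul_right,
    Finset.sum_eq_zero, zero_add]
  · rcases norm_arnoldiVec A v (j + 1) with h | h
    · rw [inner_self_eq_norm_sq_to_K, h]; simp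
    -- At a breakdown the residual itself is zero, so both sides are `0`.
    · have := norm_smul_arnoldiVec_succ A v j
      rw [h, smul_zero] at this
      simp [← this]
  · intro k hk
    rw [Finset.mem_range] at hk
    rw [inner_smul_right, inner_arnoldiVec_of_ne A v (by omega), mul_zero]

/-- The Arnoldi relation. -/
theorem map_arnoldiVec_eq_sum {j m : ℕ} (hj : j < m) :
    Matrix.toEuclideanLin A (arnoldiVec A v j) =
      (∑ i : Fin m, arnoldiCoeff A v i j • arnoldiVec A v i) +
        arnoldiCoeff A v m j • arnoldiVec A v m := by
  rw [← Finset.sum_range fun i => arnoldiCoeff A v i j • arnoldiVec A v i,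
    ← Finset.sum_range_succ, map_arnoldiVec, ← arnoldiCoeff_succ,
    ← Finset.sum_range_succ fun i => arnoldiCoeff A v i j • arnoldiVec A v i]
  refine Finset.sum_subset (Finset.range_mono (by omega)) fun i _ hi => ?_
  rw [Finset.mem_range] at hi
  rw [arnoldiCoeff_of_lt A v (by omega), zero_smul]

theorem H_apply {m : ℕ} (i j : Fin m) : H A v m i j = arnoldiCoeff A v i j := by
  rw [H, Matrix.mul_assoc, Matrix.mul_apply, arnoldiCoeff,
    EuclideanSpace.inner_eq_star_dotProduct, dotProduct]
  refine Finset.sum_congr rfl fun k _ => ?_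
  rw [mul_comm]
  rfl

theorem h_eq_norm {m : ℕ} (hm : 0 < m) : h A v m = ‖arnoldiResidual A v (m - 1)‖ := by
  obtain ⟨k, rfl⟩ : ∃ k, m = k + 1 := ⟨m - 1, by omega⟩
  rw [h, H_apply]
  simp [arnoldiCoeff_succ]

theorem norm_arnoldiVec_le (j : ℕ) : ‖arnoldiVec A v j‖ ≤ 1 := by
  rcases norm_arnoldiVec A v j with h | h <;> simp [h]

end Arnoldi

/-! ### Consequences of a nonpositive logarithmic norm -/

section Dissipative
variable {n : ℕ} {A : Matrix (Fin n) (Fin n) ℂ}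

theorem re_inner_toEuclideanLin_nonpos (hA : logNorm A ≤ 0) (x : EuclideanSpace ℂ (Fin n)) :
    (inner ℂ x (Matrix.toEuclideanLin A x)).re ≤ 0 := by
  let T : EuclideanSpace ℂ (Fin n) →L[ℂ] EuclideanSpace ℂ (Fin n) :=
    LinearMap.toContinuousLinearMap (Matrix.toEuclideanLin A)
  have key : ∀ y : EuclideanSpace ℂ (Fin n),
      (star (WithLp.ofLp y) ⬝ᵥ A.mulVec y) / (star (WithLp.ofLp y) ⬝ᵥ (WithLp.ofLp y)) =
        ((‖y‖ ^ 2)⁻¹ : ℝ) * inner ℂ y (Matrix.toEuclideanLin A y) := by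
    intro y
    have h1 : star (WithLp.ofLp y) ⬝ᵥ A.mulVec y = inner ℂ y (Matrix.toEuclideanLin A y) := by
      rw [EuclideanSpace.inner_eq_star_dotProduct, dotProduct_comm]
      rfl
    have h2 : star (WithLp.ofLp y) ⬝ᵥ (WithLp.ofLp y) = ((‖y‖ ^ 2 : ℝ) : ℂ) := by
      have := inner_self_eq_norm_sq_to_K (𝕜 := ℂ) y
      rw [EuclideanSpace.inner_eq_star_dotProduct, dotProduct_comm] at this
      rw [this]
      simp
    rw [h1, h2, div_eq_inv_mul, Complex.ofReal_inv]
  by_cases hx : x = 0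
  · simp [hx]
  -- The supremum is informative only for a set bounded above; Cauchy–Schwarz gives the bound `‖T‖`.
  have hbdd : BddAbove (Complex.re '' numericalRange A) := by
    refine ⟨‖T‖, ?_⟩
    rintro _ ⟨_, ⟨y, hy, rfl⟩, rfl⟩
    have hk := key (WithLp.toLp 2 y)
    simp only at hk
    rw [hk, Complex.re_ofReal_mul]
    set z : EuclideanSpace ℂ (Fin n) := WithLp.toLp 2 y
    have hz : 0 < ‖z‖ := norm_pos_iff.2 fun h => hy (by simpa [z] using h)
    rw [inv_mul_le_iff₀ (by positivity)]
    calc (inner ℂ z (Matrix.toEuclideanLin A z)).re ≤ ‖inner ℂ z (T z)‖ := Complex.re_le_norm _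
      _ ≤ ‖z‖ * ‖T z‖ := norm_inner_le_norm _ _
      _ ≤ ‖z‖ * (‖T‖ * ‖z‖) := by gcongr; exact T.le_opNorm z
      _ = _ := by ring
  have hle : (((‖x‖ ^ 2)⁻¹ : ℝ) * inner ℂ x (Matrix.toEuclideanLin A x) : ℂ).re ≤ 0 := by
    refine (le_csSup hbdd ⟨_, ⟨WithLp.ofLp x, fun h => hx ?_, rfl⟩, ?_⟩).trans hA
    · exact (WithLp.ofLp_eq_zero 2).1 h
    · rw [key x]
  have hx' : 0 < ‖x‖ := norm_pos_iff.2 hx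
  rw [Complex.re_ofReal_mul] at hle
  exact nonpos_of_mul_nonpos_right hle (by positivity)

/-- The norm need not be differentiable where `e` vanishes, so `√(‖e‖² + ε²)` replaces it. Its
derivative is at most `ρ`, its initial value is `ε`, and `ε` is arbitrary. -/
theorem norm_le_integral_of_re_inner_le {E : Type*} [NormedAddCommGroup E] [InnerProductSpace ℂ E]
    {e e' : ℝ → E} {ρ : ℝ → ℝ} (hρ : Continuous ρ) (hρ0 : ∀ s, 0 ≤ ρ s)
    (he : ∀ s, HasDerivAt e (e' s) s) (h0 : e 0 = 0)
    (hle : ∀ s, (inner ℂ (e s) (e' s)).re ≤ ρ s * ‖e s‖) {t : ℝ} (ht : 0 ≤ t) :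
    ‖e t‖ ≤ ∫ s in (0 : ℝ)..t, ρ s := by
  refine le_of_forall_pos_le_add fun ε hε => ?_
  have hpos : ∀ s, 0 < ‖e s‖ ^ 2 + ε ^ 2 := fun s => by positivity
  have hsq : ∀ s, HasDerivAt (fun s => ‖e s‖ ^ 2 + ε ^ 2) (2 * (inner ℂ (e s) (e' s)).re) s := by
    intro s
    have h1 := Complex.reCLM.hasFDerivAt.comp_hasDerivAt s ((he s).inner ℂ (he s))
    have h2 : (Complex.reCLM ∘ fun s => inner ℂ (e s) (e s)) = fun s => ‖e s‖ ^ 2 := by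
      funext s
      exact (norm_sq_eq_re_inner (𝕜 := ℂ) (e s)).symm
    rw [h2] at h1
    refine (h1.add_const (ε ^ 2)).congr_deriv ?_
    have h3 : (inner ℂ (e' s) (e s)).re = (inner ℂ (e s) (e' s)).re :=
      inner_re_symm (𝕜 := ℂ) (e' s) (e s)
    rw [map_add, Complex.reCLM_apply, Complex.reCLM_apply, h3, two_mul]
  have hd : ∀ s, HasDerivAt (fun s => √(‖e s‖ ^ 2 + ε ^ 2) - ∫ x in (0 : ℝ)..s, ρ x)
      (2 * (inner ℂ (e s) (e' s)).re / (2 * √(‖e s‖ ^ 2 + ε ^ 2)) - ρ s) s := fun s =>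
    ((hsq s).sqrt (hpos s).ne').sub (hρ.integral_hasStrictDerivAt 0 s).hasDerivAt
  have hanti : Antitone (fun s => √(‖e s‖ ^ 2 + ε ^ 2) - ∫ x in (0 : ℝ)..s, ρ x) := by
    refine antitone_of_deriv_nonpos (fun s => (hd s).differentiableAt) fun s => ?_
    rw [(hd s).deriv, sub_nonpos, mul_div_mul_left _ _ two_ne_zero,
      div_le_iff₀ (Real.sqrt_pos.2 (hpos s))]
    refine (hle s).trans (mul_le_mul_of_nonneg_left ?_ (hρ0 s))
    exact Real.le_sqrt_of_sq_le (by linarith [sq_nonneg ε])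
  have h1 := hanti ht
  simp only [h0, norm_zero, intervalIntegral.integral_same, sub_zero] at h1
  rw [zero_pow two_ne_zero, zero_add, Real.sqrt_sq hε.le] at h1
  have h2 : ‖e t‖ ≤ √(‖e t‖ ^ 2 + ε ^ 2) :=
    Real.le_sqrt_of_sq_le (by linarith [sq_nonneg ε])
  linarith

end Dissipative

/-! ### The defect and the error -/

section Error
variable {n : ℕ} {A : Matrix (Fin n) (Fin n) ℂ} {v : EuclideanSpace ℂ (Fin n)} {m : ℕ}

theorem phiEntry_scaled (hm : 0 < m) (p : ℕ) (s : ℝ) :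
    (s : ℂ) ^ p * phiEntry A v hm p s = scaledPhi p (H A v m) s ⟨m - 1, by omega⟩ ⟨0, hm⟩ := rfl

theorem defect_eq (hm : 0 < m) (p : ℕ) (s : ℝ) :
    defect A v hm p s = ‖v‖ * scaledPhi p (H A v m) s ⟨m - 1, by omega⟩ ⟨0, hm⟩ := by
  rw [defect, mul_assoc, phiEntry_scaled]

theorem H_hessenberg (i j : Fin m) (hij : (j : ℕ) + 1 < i) : H A v m i j = 0 := by
  rw [H_apply, arnoldiCoeff_of_lt A v hij]

theorem continuous_defect (hm : 0 < m) (p : ℕ) : Continuous (defect A v hm p) := by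
  have : defect A v hm p = fun s => _ := funext fun s => defect_eq hm p s
  rw [this]
  exact continuous_const.mul (continuous_iff_continuousAt.2 fun s =>
    (hasDerivAt_scaledPhi_matrix_apply p (H A v m) s _ _).continuousAt)

theorem integral_defect (hm : 0 < m) (p : ℕ) (t : ℝ) :
    ∫ s in (0 : ℝ)..t, defect A v hm p s =
      ‖v‖ * ((t : ℂ) ^ (p + 1) * phiEntry A v hm (p + 1) t) := by
  rw [phiEntry_scaled, intervalIntegral.integral_eq_sub_of_hasDerivAt
    (f := fun s => ‖v‖ * scaledPhi (p + 1) (H A v m) s ⟨m - 1, by omega⟩ ⟨0, hm⟩)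
    (fun s _ => by
      rw [defect_eq]
      exact (hasDerivAt_scaledPhi_matrix_succ_apply p (H A v m) s _ _).const_mul _)
    ((continuous_defect hm p).intervalIntegrable _ _), scaledPhi_matrix_succ_zero]
  simp

open scoped ComplexOrder in
theorem defectIntegral_eq (hm : 0 < m) {p : ℕ} {t : ℝ} (ht : 0 < t)
    (hpos : ∀ s, 0 ≤ s → 0 ≤ scaledPhi p (H A v m) s ⟨m - 1, by omega⟩ ⟨0, hm⟩) :
    (defectIntegral A v hm p t : ℂ) =
      (‖v‖ : ℂ) * (h A v m : ℂ) * (t : ℂ) * phiEntry A v hm (p + 1) t := by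
  have h1 : ((∫ s in (0 : ℝ)..t, ‖defect A v hm p s‖ : ℝ) : ℂ) =
      ∫ s in (0 : ℝ)..t, defect A v hm p s := by
    rw [← intervalIntegral.integral_ofReal]
    refine intervalIntegral.integral_congr fun s hs => ?_
    rw [Set.uIcc_of_le ht.le] at hs
    refine (Complex.eq_coe_norm_of_nonneg ?_).symm
    rw [defect_eq]
    exact mul_nonneg (Complex.zero_le_real.2 (norm_nonneg v)) (hpos s hs.1)
  have ht' : (t : ℂ) ^ p ≠ 0 := pow_ne_zero _ (by exact_mod_cast ht.ne')
  rw [defectIntegral, Complex.ofReal_mul, h1, integral_defect, Complex.ofReal_div,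
    Complex.ofReal_pow, pow_succ]
  field_simp

theorem hasDerivAt_scaledPhi_mulVec (p : ℕ) (s : ℝ) :
    HasDerivAt (fun s => (WithLp.toLp 2 ((scaledPhi p A s).mulVec v) : EuclideanSpace ℂ (Fin n)))
      ((source p s : ℂ) • v +
        Matrix.toEuclideanLin A (WithLp.toLp 2 ((scaledPhi p A s).mulVec v))) s := by
  have h1 : HasDerivAt (fun s => (scaledPhi p A s).mulVec v)
      (((source p s : ℂ) • (1 : Matrix (Fin n) (Fin n) ℂ) + A * scaledPhi p A s).mulVec v) s :=
    hasDerivAt_pi.2 fun i => by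
      simp only [Matrix.mulVec, dotProduct]
      exact HasDerivAt.fun_sum fun k _ =>
        (hasDerivAt_scaledPhi_matrix_apply p A s i k).mul_const (v k)
  have h2 := ((PiLp.continuousLinearEquiv 2 ℝ fun _ : Fin n => ℂ).symm
    |>.toContinuousLinearMap.hasFDerivAt.comp_hasDerivAt s h1)
  refine h2.congr_deriv ?_
  rw [Matrix.add_mulVec, Matrix.smul_mulVec, Matrix.one_mulVec, ← Matrix.mulVec_mulVec]
  rfl

/-- The Krylov approximation, scaled by `s ^ p`. -/
def scaledKrylov (A : Matrix (Fin n) (Fin n) ℂ) (v : EuclideanSpace ℂ (Fin n)) (hm : 0 < m)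
    (p : ℕ) (s : ℝ) : EuclideanSpace ℂ (Fin n) :=
  ∑ j : Fin m, (‖v‖ * scaledPhi p (H A v m) s j ⟨0, hm⟩) • arnoldiVec A v j

/-- This is the relation `A V_m = V_m H_m + h_{m+1,m} v_{m+1} e_m^*` applied to the equation of `s^p
φ_p(s H_m) e_1`. -/
theorem hasDerivAt_scaledKrylov (hm : 0 < m) (p : ℕ) (s : ℝ) :
    HasDerivAt (scaledKrylov A v hm p)
      ((source p s : ℂ) • v + Matrix.toEuclideanLin A (scaledKrylov A v hm p s) -
        ((h A v m : ℂ) * defect A v hm p s) • arnoldiVec A v m) s := by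
  have h1 : HasDerivAt (scaledKrylov A v hm p) _ s := HasDerivAt.fun_sum fun j _ =>
    ((hasDerivAt_scaledPhi_matrix_apply p (H A v m) s j ⟨0, hm⟩).const_mul
      (‖v‖ : ℂ)).smul_const (arnoldiVec A v j)
  refine h1.congr_deriv ?_
  set y : Fin m → ℂ := fun j => scaledPhi p (H A v m) s j ⟨0, hm⟩ with hy
  have hA : Matrix.toEuclideanLin A (scaledKrylov A v hm p s) =
      (∑ j : Fin m, (‖v‖ * ∑ k, H A v m j k * y k) • arnoldiVec A v j) +
        ((h A v m : ℂ) * defect A v hm p s) • arnoldiVec A v m := by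
    -- Only the last column of `A V_m` leaves the span of the first `m` vectors.
    have h2 : ∀ k : Fin m, Matrix.toEuclideanLin A (arnoldiVec A v k) =
        (∑ j : Fin m, H A v m j k • arnoldiVec A v j) +
          (if k = ⟨m - 1, by omega⟩ then (h A v m : ℂ) else 0) • arnoldiVec A v m := by
      intro k
      rw [map_arnoldiVec_eq_sum A v k.2]
      simp only [H_apply]
      congr 2
      split_ifs with hk
      · obtain ⟨r, rfl⟩ : ∃ r, m = r + 1 := ⟨m - 1, by omega⟩
        rw [h_eq_norm A v hm, hk]
        exact arnoldiCoeff_succ A v r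
      · refine arnoldiCoeff_of_lt A v ?_
        have : (k : ℕ) ≠ m - 1 := fun h => hk (Fin.ext h)
        omega
    simp only [scaledKrylov, map_sum, map_smul, h2, smul_add, Finset.sum_add_distrib]
    congr 1
    · simp only [Finset.smul_sum, smul_smul, Finset.mul_sum, Finset.sum_smul]
      rw [Finset.sum_comm]
      refine Finset.sum_congr rfl fun j _ => Finset.sum_congr rfl fun k _ => ?_
      congr 1
      simp only [hy]
      ring
    · simp only [smul_smul, ← Finset.sum_smul]
      congr 1
      simp only [mul_ite, mul_zero, Finset.sum_ite_eq', Finset.mem_univ, if_true]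
      rw [defect_eq]
      ring
  rw [hA, add_sub_assoc, add_sub_cancel_right]
  simp only [Matrix.add_apply, mul_add, add_smul, Finset.sum_add_distrib]
  congr 1
  -- The source acts on `e_1` alone, and `β v_1 = v`.
  · rw [Finset.sum_eq_single ⟨0, hm⟩]
    · rw [Matrix.smul_apply, Matrix.one_apply_eq, smul_eq_mul, mul_one, mul_comm, mul_smul,
        norm_smul_arnoldiVec_zero]
    · intro j _ hj
      rw [Matrix.smul_apply, Matrix.one_apply_ne hj]
      simp
    · simp

theorem scaledKrylov_sub_zero (hm : 0 < m) (p : ℕ) :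
    scaledKrylov A v hm p 0 - WithLp.toLp 2 ((scaledPhi p A 0).mulVec v) = 0 := by
  cases p with
  | zero =>
    rw [scaledKrylov, Finset.sum_eq_single ⟨0, hm⟩]
    · rw [scaledPhi_matrix_zero_zero, Matrix.one_apply_eq, mul_one, norm_smul_arnoldiVec_zero,
        scaledPhi_matrix_zero_zero, Matrix.one_mulVec]
      exact sub_self v
    · intro j _ hj
      rw [scaledPhi_matrix_zero_zero, Matrix.one_apply_ne hj]
      simp
    · simp
  | succ p => simp [scaledKrylov, scaledPhi_matrix_succ_zero]

theorem pow_smul_error (hm : 0 < m) (p : ℕ) (s : ℝ) :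
    (s : ℂ) ^ p • error A v hm p s =
      scaledKrylov A v hm p s - WithLp.toLp 2 ((scaledPhi p A s).mulVec v) := by
  ext i
  simp only [error, scaledKrylov, scaledPhi, PiLp.smul_apply, PiLp.sub_apply, Pi.sub_apply,
    Pi.smul_apply, smul_eq_mul, mul_sub, Matrix.smul_mulVec, WithLp.ofLp_sum, Finset.sum_apply,
    Matrix.mulVec_single_one, Matrix.smul_apply, WithLp.ofLp_smul]
  congr 1
  simp only [Matrix.mulVec, dotProduct, V, Matrix.of_apply, Matrix.col_apply, Finset.mul_sum]
  refine Finset.sum_congr rfl fun j _ => ?_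
  ring

theorem norm_error_le (hm : 0 < m) (hA : logNorm A ≤ 0) (p : ℕ) {t : ℝ} (ht : 0 < t) :
    ‖error A v hm p t‖ ≤ defectIntegral A v hm p t := by
  have hh : 0 ≤ h A v m := by rw [h_eq_norm A v hm]; exact norm_nonneg _
  have key := norm_le_integral_of_re_inner_le
    (e := fun s => scaledKrylov A v hm p s -
      (WithLp.toLp 2 ((scaledPhi p A s).mulVec v) : EuclideanSpace ℂ (Fin n)))
    (ρ := fun s => h A v m * ‖defect A v hm p s‖)
    (continuous_const.mul (continuous_defect hm p).norm) (fun s => by positivity)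
    (fun s => (hasDerivAt_scaledKrylov hm p s).sub (hasDerivAt_scaledPhi_mulVec p s))
    (scaledKrylov_sub_zero hm p) (fun s => ?_) ht.le
  · have htp : 0 < t ^ p := by positivity
    simp only [← pow_smul_error] at key
    rw [norm_smul, norm_pow, Complex.norm_real, Real.norm_of_nonneg ht.le,
      intervalIntegral.integral_const_mul] at key
    rw [defectIntegral, div_mul_eq_mul_div, le_div_iff₀ htp, mul_comm]
    exact key
  · set x := scaledKrylov A v hm p s
    set u : EuclideanSpace ℂ (Fin n) := WithLp.toLp 2 ((scaledPhi p A s).mulVec v)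
    -- Both curves have the same source, so it cancels in the error equation.
    have h1 : (source p s : ℂ) • v + Matrix.toEuclideanLin A x -
        ((h A v m : ℂ) * defect A v hm p s) • arnoldiVec A v m -
          ((source p s : ℂ) • v + Matrix.toEuclideanLin A u) =
        Matrix.toEuclideanLin A (x - u) -
          ((h A v m : ℂ) * defect A v hm p s) • arnoldiVec A v m := by
      rw [map_sub]
      abel
    rw [h1, inner_sub_right, Complex.sub_re]
    have h2 := re_inner_toEuclideanLin_nonpos hA (x - u)
    have h3 : -(inner ℂ (x - u) (((h A v m : ℂ) * defect A v hm p s) • arnoldiVec A v m)).re ≤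
        ‖x - u‖ * (h A v m * ‖defect A v hm p s‖ * 1) := by
      refine (neg_le_abs _).trans ((Complex.abs_re_le_norm _).trans
        ((norm_inner_le_norm _ _).trans ?_))
      rw [norm_smul, norm_mul, Complex.norm_real, Real.norm_of_nonneg hh]
      gcongr
      exact norm_arnoldiVec_le A v m
    linarith

end Error
end Krylov
end

open scoped ComplexOrder in
theorem Krylov.H_subdiag_nonneg {n m : ℕ} (A : Matrix (Fin n) (Fin n) ℂ)
    (v : EuclideanSpace ℂ (Fin n)) (j : Fin (m - 1)) :
    0 ≤ Krylov.H A v m ⟨j + 1, by omega⟩ ⟨j, by omega⟩ := by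
  rw [Krylov.H_apply, Krylov.arnoldiCoeff_succ]
  exact Complex.zero_le_real.2 (norm_nonneg _)

/-- `lam` lists the eigenvalues of `H_m` with their algebraic multiplicities, in any order.  The
linear independence says that the Krylov space of `A` and `v` has dimension `m`. -/
theorem corollary4p1 {n m : ℕ} (hm : 0 < m)
    (A : Matrix (Fin n) (Fin n) ℂ) (v : EuclideanSpace ℂ (Fin n))
    (hK : LinearIndependent ℂ (fun k : Fin m => (A ^ (k : ℕ)).mulVec (WithLp.ofLp v)))
    (hA : Krylov.logNorm A ≤ 0)
    (lam : Fin m → ℂ)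
    (hlam : (Krylov.H A v m).charpoly = ∏ j, (Polynomial.X - Polynomial.C (lam j)))
    (hreal : ∀ j, (lam j).im = 0)
    (p : ℕ) (t : ℝ) (ht : 0 < t) :
    (Krylov.defectIntegral A v hm p t : ℂ) = Krylov.realPartBound A v hm p t lam ∧
    ‖Krylov.error A v hm p t‖ ≤ Krylov.defectIntegral A v hm p t ∧
    (Krylov.defectIntegral A v hm p t : ℂ) =
      (‖v‖ : ℂ) * (Krylov.h A v m : ℂ) * (t : ℂ) * Krylov.phiEntry A v hm (p + 1) t := by
  have hL := Krylov.defectIntegral_eq (A := A) (v := v) hm ht fun s hs =>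
    Krylov.scaledPhi_apply_nonneg hm Krylov.H_hessenberg hlam hreal
      (Krylov.H_subdiag_nonneg A v) p hs
  refine ⟨?_, Krylov.norm_error_le hm hA p ht, hL⟩
  have hre : (fun j => ((lam j).re : ℂ)) = lam :=
    funext fun j => Complex.ext rfl (by simp [hreal j])
  have hdd : Krylov.phiEntry A v hm (p + 1) t =
      Krylov.gamma A v m * Krylov.divDiff (fun z => Krylov.phi (p + 1) ((t : ℂ) * z)) hm lam :=
    (Krylov.isMatrixFun_phi (p + 1) (t : ℂ)).apply_eq_mul_divDiff hm Krylov.H_hessenberg hlam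
  rw [hL, hdd, Krylov.realPartBound, hre]
  ring
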